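/- Let $\mathbf{OpLC}$ be the category of locally compact Hausdorff spaces and continuous open maps (not necessarily onto). A *local contact algebra* $(B,\rho,\mathbb{B})$ consists of a Boolean algebra $B$ (with $0=1$ allowed), a binary relation $\rho$ on $B$, and an ideal $\mathbb{B}$ of $B$ (possibly not proper), whose elements are called bounded, such that for all $a,b,c\in B$, writing $a\ll c$ for "not $a\,\rho\,c^*$", where $c^*$ is the complement of $c$: - $a\neq 0$ implies $a\,\rho\,a$; $a\,\rho\,b$ implies $a\neq0$ and $b\neq 0$; $a\,\rho\,b$ implies $b\,\rho\,a$; $a\,\rho\,(b\vee c)$ if and only if $a\,\rho\,b$ or $a\,\rho\,c$; - if $a\in\mathbb{B}$ and $a\ll c$, then $a\ll d\ll c$ for some $d\in\mathbb{B}$; - if $a\,\rho\,b$, then $a\,\rho\,(d\wedge b)$ for some $d\in\mathbb{B}$; - if $a\neq0$, then there is $d\in\mathbb{B}$ with $d\neq0$ and $d\ll a$. It is *complete* if the Boolean algebra $B$ is complete. Let $\mathbf{EOpLC}$ be the category whose objects are all complete local contact algebras and whose morphisms $\psi:(A,\rho,\mathbb{B})\to(B,\eta,\mathbb{B}')$ are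 all functions $\psi:A\to B$, composed as functions, such that - (EF1) for every $a\in A$, $\psi(a)=0$ if and only if $a=0$; - (EF2) $\psi$ preserves all joins; - (EF3) if $a\in A$, $b\in B$ and $b\le\psi(a)$, then there is $c\in A$ with $c\le a$ and $\psi(c)=b$; - (EL4) $a\,\rho\,b$ implies $\psi(a)\,\eta\,\psi(b)$, for all $a,b\in A$; - (EL5) if $a\in\mathbb{B}$, then $\psi(a)\in\mathbb{B}'$; - (EL7) if $a\in\mathbb{B}$, $b\in B$ and $\psi(a)\,\eta\,b$, then $a\,\rho\,\psi_P(b)$, where $\psi_P:B\to A$, $\psi_P(b)=\bigvee\{a\in A : \psi(a)\le b\}$, is the right adjoint of $\psi$. Then the categories $\mathbf{OpLC}$ and $\mathbf{EOpLC}$ are equivalent. -/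

import Mathlib

open CategoryTheory

universe u v w

/-! ### Contact algebras and local contact algebras -/

/-- `C` is a contact relation on the Boolean algebra `B`. -/
structure IsContactRelation {B : Type u} [BooleanAlgebra B] (C : B → B → Prop) : Prop where
  refl_of_ne_bot : ∀ a, a ≠ ⊥ → C a a
  ne_bot : ∀ a b, C a b → a ≠ ⊥ ∧ b ≠ ⊥
  symm : ∀ a b, C a b → C b a
  sup_right : ∀ a b c, C a (b ⊔ c) ↔ C a b ∨ C a c

/-- Non-tangential inclusion `a ≪_C b`: not `a C b*`. -/
def NonTangential {B : Type u} [BooleanAlgebra B] (C : B → B → Prop) (a b : B) : Prop :=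
  ¬ C a bᶜ

/-- The structure of a local contact algebra on a Boolean algebra `B`: a contact relation `ρ`
(the field `contact`) and an ideal, possibly not proper, of bounded elements. -/
structure LocalContactStructure (B : Type u) [BooleanAlgebra B] where
  /-- the contact relation `ρ` -/
  contact : B → B → Prop
  isContact : IsContactRelation contact
  /-- the ideal of bounded elements -/
  bounded : Order.Ideal B
  interpolate : ∀ a ∈ bounded, ∀ c, NonTangential contact a c →
    ∃ b ∈ bounded, NonTangential contact a b ∧ NonTangential contact b c
  exists_bounded_contact : ∀ a b, contact a b → ∃ c ∈ bounded, contact a (c ⊓ b)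
  exists_bounded_nonTangential : ∀ a, a ≠ ⊥ →
    ∃ b ∈ bounded, b ≠ ⊥ ∧ NonTangential contact b a

/-! ### Morphisms -/

/-- The right adjoint `ψ_P` of a join-preserving map `ψ` between complete lattices; see
`galoisConnection_rightAdj`. -/
def rightAdj {A : Type u} {B : Type v} [CompleteLattice A] [CompleteLattice B]
    (ψ : A → B) (b : B) : A :=
  sSup {a | ψ a ≤ b}

theorem galoisConnection_rightAdj {A : Type u} {B : Type v} [CompleteLattice A]
    [CompleteLattice B] {ψ : A → B} (h : ∀ S : Set A, ψ (sSup S) = sSup (ψ '' S)) :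
    GaloisConnection ψ (rightAdj ψ) := by
  have hm : Monotone ψ := fun a b hab => by
    have h2 := h {a, b}
    rw [sSup_pair, sup_eq_right.2 hab, Set.image_pair, sSup_pair] at h2
    exact sup_eq_right.1 h2.symm
  intro a b
  refine ⟨fun hab => le_sSup hab, fun hab => (hm hab).trans ?_⟩
  rw [rightAdj, h]
  refine sSup_le ?_
  rintro _ ⟨c, hc, rfl⟩
  exact hc

/-- The morphisms of the category `ESkeLC`: maps `ψ : A → B` between (the underlying sets of)
complete local contact algebras that vanish only at `0`, preserve all joins, have downward closed
range over each `{c | c ≤ a}`, and preserve contact and boundedness. -/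
structure IsESkeLCMorphism {A : Type u} {B : Type v} [CompleteBooleanAlgebra A]
    [CompleteBooleanAlgebra B] (α : LocalContactStructure A) (β : LocalContactStructure B)
    (ψ : A → B) : Prop where
  eq_bot_iff : ∀ a, ψ a = ⊥ ↔ a = ⊥
  map_sSup : ∀ S : Set A, ψ (sSup S) = sSup (ψ '' S)
  exists_map_eq : ∀ a b, b ≤ ψ a → ∃ c, c ≤ a ∧ ψ c = b
  map_contact : ∀ a b, α.contact a b → β.contact (ψ a) (ψ b)
  map_bounded : ∀ a ∈ α.bounded, ψ a ∈ β.bounded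

/-- The morphisms of the category `EOpLC`: the `ESkeLC`-morphisms `ψ` such that, for bounded `a`,
`ψ a η b` implies `a ρ ψ_P b`. -/
structure IsEOpLCMorphism {A : Type u} {B : Type v} [CompleteBooleanAlgebra A]
    [CompleteBooleanAlgebra B] (α : LocalContactStructure A) (β : LocalContactStructure B)
    (ψ : A → B) : Prop extends IsESkeLCMorphism α β ψ where
  contact_rightAdj : ∀ a ∈ α.bounded, ∀ b, β.contact (ψ a) b → α.contact a (rightAdj ψ b)

theorem IsEOpLCMorphism.id {A : Type u} [CompleteBooleanAlgebra A]
    (α : LocalContactStructure A) : IsEOpLCMorphism α α (fun a => a) where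
  eq_bot_iff _ := Iff.rfl
  map_sSup S := by simp
  exists_map_eq _ b h := ⟨b, h, rfl⟩
  map_contact _ _ h := h
  map_bounded _ h := h
  contact_rightAdj a _ b h := by
    have : rightAdj (fun a : A => a) b = b := (isLUB_Iic (a := b)).sSup_eq
    rwa [this]

theorem IsEOpLCMorphism.comp {A : Type u} {B : Type v} {D : Type w} [CompleteBooleanAlgebra A]
    [CompleteBooleanAlgebra B] [CompleteBooleanAlgebra D] {α : LocalContactStructure A}
    {β : LocalContactStructure B} {δ : LocalContactStructure D} {χ : B → D} {ψ : A → B}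
    (hχ : IsEOpLCMorphism β δ χ) (hψ : IsEOpLCMorphism α β ψ) :
    IsEOpLCMorphism α δ (fun a => χ (ψ a)) where
  eq_bot_iff a := (hχ.eq_bot_iff _).trans (hψ.eq_bot_iff a)
  map_sSup S := by rw [hψ.map_sSup, hχ.map_sSup, Set.image_image]
  exists_map_eq a b h := by
    obtain ⟨c, hc, rfl⟩ := hχ.exists_map_eq _ _ h
    obtain ⟨d, hd, rfl⟩ := hψ.exists_map_eq _ _ hc
    exact ⟨d, hd, rfl⟩
  map_contact a b h := hχ.map_contact _ _ (hψ.map_contact a b h)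
  map_bounded a h := hχ.map_bounded _ (hψ.map_bounded a h)
  contact_rightAdj a ha b h := by
    have h1 := hψ.contact_rightAdj a ha _ (hχ.contact_rightAdj _ (hψ.map_bounded a ha) b h)
    have h2 : rightAdj ψ (rightAdj χ b) = rightAdj (fun a => χ (ψ a)) b := by
      refine congrArg sSup (Set.ext fun x => ?_)
      exact (galoisConnection_rightAdj hχ.map_sSup (ψ x) b).symm
    rwa [h2] at h1

/-! ### The category `EOpLC` -/

/-- The objects of `EOpLC`: complete local contact algebras. -/
structure EOpLC : Type (u + 1) where
  carrier : Type u
  [alg : CompleteBooleanAlgebra carrier]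
  str : LocalContactStructure carrier

attribute [instance] EOpLC.alg

/-- The morphisms of `EOpLC`. -/
@[ext]
structure EOpLC.Hom (A B : EOpLC.{u}) : Type u where
  toFun : A.carrier → B.carrier
  isMorphism : IsEOpLCMorphism A.str B.str toFun

instance EOpLC.category : Category.{u} EOpLC.{u} where
  Hom := EOpLC.Hom
  id A := ⟨fun a => a, IsEOpLCMorphism.id A.str⟩
  comp f g := ⟨fun a => g.toFun (f.toFun a), g.isMorphism.comp f.isMorphism⟩

/-! ### The category `OpLC` -/

/-- The objects of `OpLC`: locally compact Hausdorff spaces. -/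
structure OpLC : Type (u + 1) where
  carrier : Type u
  [top : TopologicalSpace carrier]
  [locallyCompact : LocallyCompactSpace carrier]
  [t2 : T2Space carrier]

attribute [instance] OpLC.top OpLC.locallyCompact OpLC.t2

/-- The morphisms of `OpLC` are the continuous open maps, not necessarily onto. -/
instance OpLC.category : Category.{u} OpLC.{u} where
  Hom X Y := X.carrier →CO Y.carrier
  id X := ContinuousOpenMap.id X.carrier
  comp f g := ContinuousOpenMap.comp g f

open Set TopologicalSpace Topology

/-! ### Regular open sets -/

/-! The equivalence sends a space `X` to its algebra of regular open sets, where contact means that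
closures meet and bounded means that the closure is compact, and sends `f` to the direct image `U ↦
int cl f(U)`. This functor is shown to be faithful, full and essentially surjective.

Faithfulness is a Hausdorff separation argument. For fullness, a morphism `ψ` yields a point map:
compactness provides a point common to all `cl ψ(U)` with `x ∈ U`. Everything then rests on
`pointMap_mem_closure_iff`: this point lies in `cl V` exactly when `x ∈ cl ψ_P(V)`, which is where
(EL4) and (EL7) enter. Continuity is immediate from it; openness follows from
`image_pointMap_closure` and `pointMap_mem_toSet`; and `map_openMap` recovers `ψ` because every
regular open set is a join of bounded ones.

For essential surjectivity, the points of an algebra are its bounded round filters that decide every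
pair `b ≪ a`. The sets `basic α a` of points containing `a` are regular open, since the closure of
`basic α a` is the complement of `basic α aᶜ`. Completeness makes every regular open set of this
form, and compactness translates contact and boundedness (`contact_iff`,
`isCompact_closure_basic_iff`). -/

noncomputable instance Heyting.Regular.completeBooleanAlgebra {α : Type u} [Order.Frame α] :
    CompleteBooleanAlgebra (Heyting.Regular α) :=
  { (inferInstance : BooleanAlgebra (Heyting.Regular α)),
    Heyting.Regular.gi.liftCompleteLattice with }

/-- The complete Boolean algebra of regular open subsets of a topological space. -/
abbrev RegularOpens (X : Type u) [TopologicalSpace X] : Type u := Heyting.Regular (Opens X)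

namespace RegularOpens

section Basic

variable {X : Type u} [TopologicalSpace X]

/-- The underlying set of a regular open set. -/
def toSet (U : RegularOpens X) : Set X := (U.val : Set X)

/-- The interior of the closure of an open set, as a regular open set. -/
def regularize (s : Set X) (hs : IsOpen s) : RegularOpens X :=
  Heyting.Regular.toRegular (⟨s, hs⟩ : Opens X)

theorem isOpen_toSet (U : RegularOpens X) : IsOpen U.toSet := U.val.isOpen

theorem toSet_compl (U : RegularOpens X) : (Uᶜ).toSet = (closure U.toSet)ᶜ := by
  change (((U.val)ᶜ : Opens X) : Set X) = _
  rw [Opens.coe_compl_eq_interior_compl, interior_compl]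
  rfl

theorem toSet_eq_compl_closure (V : RegularOpens X) : V.toSet = (closure (Vᶜ).toSet)ᶜ := by
  rw [← toSet_compl, compl_compl]

theorem toSet_regularize (s : Set X) (hs : IsOpen s) :
    (regularize s hs).toSet = interior (closure s) := by
  change (((⟨s, hs⟩ : Opens X)ᶜᶜ : Opens X) : Set X) = _
  rw [Opens.coe_compl_eq_interior_compl, Opens.coe_compl_eq_interior_compl, ← closure_compl,
    compl_compl]
  rfl

theorem closure_regularize (s : Set X) (hs : IsOpen s) :
    closure (regularize s hs).toSet = closure s := by
  rw [toSet_regularize]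
  exact (closure_minimal interior_subset isClosed_closure).antisymm
    (closure_mono (interior_maximal subset_closure hs))

theorem subset_regularize (s : Set X) (hs : IsOpen s) : s ⊆ (regularize s hs).toSet := by
  rw [toSet_regularize]
  exact interior_maximal subset_closure hs

theorem interior_closure_toSet (U : RegularOpens X) : interior (closure U.toSet) = U.toSet := by
  rw [← toSet_regularize _ U.isOpen_toSet]
  exact congrArg toSet (Heyting.Regular.toRegular_coe U)

theorem le_iff {U V : RegularOpens X} : U ≤ V ↔ U.toSet ⊆ V.toSet := Iff.rfl

theorem toSet_injective : Function.Injective (toSet : RegularOpens X → Set X) :=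
  SetLike.coe_injective.comp Heyting.Regular.coe_injective

theorem le_iff_subset_closure {U V : RegularOpens X} : U ≤ V ↔ U.toSet ⊆ closure V.toSet :=
  ⟨fun h => (le_iff.1 h).trans subset_closure, fun h => by
    rw [le_iff, ← V.interior_closure_toSet]
    exact interior_maximal h U.isOpen_toSet⟩

/-- A regular open set is the interior of its closure. Equalities below are checked on closures,
where joins and direct images have simple descriptions free of `int cl`. -/
theorem eq_of_closure_eq {U V : RegularOpens X} (h : closure U.toSet = closure V.toSet) :
    U = V :=
  toSet_injective (by rw [← U.interior_closure_toSet, h, V.interior_closure_toSet])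

theorem toSet_bot : (⊥ : RegularOpens X).toSet = ∅ := rfl

theorem eq_bot_iff_toSet {U : RegularOpens X} : U = ⊥ ↔ U.toSet = ∅ :=
  toSet_injective.eq_iff.symm

theorem closure_toSet_sup (U V : RegularOpens X) :
    closure (U ⊔ V).toSet = closure U.toSet ∪ closure V.toSet := by
  rw [← closure_union]
  exact closure_regularize _ (U.val ⊔ V.val).isOpen

theorem closure_toSet_sSup (S : Set (RegularOpens X)) :
    closure (sSup S).toSet = closure (⋃ U ∈ S, U.toSet) := by
  have h : (⋃ U ∈ S, U.toSet) = ((sSup (Heyting.Regular.val '' S) : Opens X) : Set X) := by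
    ext x
    simp [toSet]
  rw [h]
  exact closure_regularize _ (sSup (Heyting.Regular.val '' S)).isOpen

/-- Regularizing the interior of an intermediate compact set `L` stays within `L`, because `L` is
closed. This is the topological source of the interpolation axiom. -/
theorem exists_between [LocallyCompactSpace X] [T2Space X] {K O : Set X} (hK : IsCompact K)
    (hO : IsOpen O) (h : K ⊆ O) :
    ∃ W : RegularOpens X, K ⊆ W.toSet ∧ closure W.toSet ⊆ O ∧ IsCompact (closure W.toSet) := by
  obtain ⟨L, hL, hKL, hLO⟩ := exists_compact_between hK hO h
  have hW : closure (interior L) ⊆ L := closure_minimal interior_subset hL.isClosed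
  refine ⟨regularize (interior L) isOpen_interior, hKL.trans (subset_regularize _ _), ?_, ?_⟩
  · rw [closure_regularize]
    exact hW.trans hLO
  · rw [closure_regularize]
    exact hL.of_isClosed_subset isClosed_closure hW

theorem exists_mem_between [LocallyCompactSpace X] [T2Space X] {x : X} {O : Set X}
    (hO : IsOpen O) (h : x ∈ O) :
    ∃ W : RegularOpens X, x ∈ W.toSet ∧ closure W.toSet ⊆ O ∧ IsCompact (closure W.toSet) := by
  simpa using exists_between (isCompact_singleton (x := x)) hO (singleton_subset_iff.2 h)

theorem exists_mem_disjoint [LocallyCompactSpace X] [T2Space X] {x y : X} (h : x ≠ y) :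
    ∃ U V : RegularOpens X, x ∈ U.toSet ∧ y ∈ V.toSet ∧
      Disjoint (closure U.toSet) (closure V.toSet) := by
  obtain ⟨U, hxU, hU, -⟩ := exists_mem_between isOpen_compl_singleton (mem_compl_singleton_iff.2 h)
  obtain ⟨V, hyV, hV, -⟩ := exists_mem_between isClosed_closure.isOpen_compl
    (fun hy : y ∈ closure U.toSet => hU hy rfl)
  exact ⟨U, V, hxU, hyV, disjoint_left.2 fun z hz hz' => hV hz' hz⟩

end Basic

/-! ### The local contact algebra of a locally compact Hausdorff space -/

section Contact

variable (X : Type u) [TopologicalSpace X]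

/-- Two regular open sets are in contact if their closures meet. -/
def Contact (U V : RegularOpens X) : Prop := (closure U.toSet ∩ closure V.toSet).Nonempty

variable {X}

theorem nonTangential_iff {U V : RegularOpens X} :
    NonTangential (Contact X) U V ↔ closure U.toSet ⊆ V.toSet := by
  rw [NonTangential, Contact, toSet_compl, closure_compl, interior_closure_toSet,
    inter_compl_nonempty_iff, not_not]

theorem isContactRelation_contact : IsContactRelation (Contact X) where
  refl_of_ne_bot U h := by
    rw [Contact, inter_self]
    exact (nonempty_iff_ne_empty.2 fun h' => h (eq_bot_iff_toSet.2 h')).closure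
  ne_bot U V h := by
    constructor <;> rintro rfl <;> simp [Contact, toSet_bot] at h
  symm U V h := by rwa [Contact, inter_comm]
  sup_right U V W := by
    simp only [Contact, closure_toSet_sup, inter_union_distrib_left, union_nonempty]

/-- The ideal of regular open sets with compact closure. -/
def boundedIdeal (X : Type u) [TopologicalSpace X] : Order.Ideal (RegularOpens X) where
  carrier := {U | IsCompact (closure U.toSet)}
  lower' _ _ h hU := hU.of_isClosed_subset isClosed_closure (closure_mono h)
  nonempty' := ⟨⊥, by simp [toSet_bot]⟩
  directed' U hU V hV := ⟨U ⊔ V, by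
    simpa only [mem_ofPred_eq, closure_toSet_sup] using IsCompact.union hU hV,
    le_sup_left, le_sup_right⟩

theorem mem_boundedIdeal {U : RegularOpens X} :
    U ∈ boundedIdeal X ↔ IsCompact (closure U.toSet) := Iff.rfl

/-- The local contact structure on the regular open sets of a locally compact Hausdorff space. -/
def localContactStructure (X : Type u) [TopologicalSpace X] [LocallyCompactSpace X] [T2Space X] :
    LocalContactStructure (RegularOpens X) where
  contact := Contact X
  isContact := isContactRelation_contact
  bounded := boundedIdeal X
  interpolate U hU V hUV := by
    obtain ⟨W, hUW, hWV, hW⟩ := exists_between hU V.isOpen_toSet (nonTangential_iff.1 hUV)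
    exact ⟨W, hW, nonTangential_iff.2 hUW, nonTangential_iff.2 hWV⟩
  exists_bounded_contact U V := by
    rintro ⟨x, hxU, hxV⟩
    obtain ⟨W, hxW, -, hW⟩ := exists_mem_between isOpen_univ (mem_univ x)
    refine ⟨W, hW, x, hxU, ?_⟩
    exact W.isOpen_toSet.inter_closure ⟨hxW, hxV⟩
  exists_bounded_nonTangential U hU := by
    obtain ⟨x, hx⟩ := nonempty_iff_ne_empty.2 fun h' => hU (eq_bot_iff_toSet.2 h')
    obtain ⟨W, hxW, hWU, hW⟩ := exists_mem_between U.isOpen_toSet hx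
    refine ⟨W, hW, ?_, nonTangential_iff.2 hWU⟩
    rintro rfl
    exact hxW

end Contact

/-! ### Direct images along continuous open maps -/

section Map

variable {X : Type u} {Y : Type v} [TopologicalSpace X] [TopologicalSpace Y]

/-- The regular open set generated by the image of a regular open set under an open map. -/
def map (f : X →CO Y) (U : RegularOpens X) : RegularOpens Y :=
  regularize (f '' U.toSet) (f.map_open' _ U.isOpen_toSet)

theorem closure_toSet_map (f : X →CO Y) (U : RegularOpens X) :
    closure (map f U).toSet = closure (f '' U.toSet) :=
  closure_regularize _ _

/-- Allows a set under `f` to be replaced by any other with the same closure, in particular by its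
regularization. -/
theorem closure_image_closure {f : X → Y} (hf : Continuous f) (s : Set X) :
    closure (f '' closure s) = closure (f '' s) :=
  (closure_minimal (image_closure_subset_closure_image hf) isClosed_closure).antisymm
    (closure_mono (image_mono subset_closure))

theorem closure_toSet_map_of_isCompact [T2Space Y] (f : X →CO Y) {U : RegularOpens X}
    (hU : IsCompact (closure U.toSet)) :
    closure (map f U).toSet = f '' closure U.toSet := by
  rw [closure_toSet_map, ← closure_image_closure (map_continuous f)]
  exact (hU.image (map_continuous f)).isClosed.closure_eq

theorem map_le_iff (f : X →CO Y) {U : RegularOpens X} {V : RegularOpens Y} :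
    map f U ≤ V ↔ f '' U.toSet ⊆ closure V.toSet :=
  le_iff_subset_closure.trans
    ⟨(subset_regularize _ _).trans, fun h => subset_closure.trans
      ((closure_toSet_map f U).trans_subset (closure_minimal h isClosed_closure))⟩

variable [LocallyCompactSpace X] [T2Space X] [LocallyCompactSpace Y] [T2Space Y]

theorem isEOpLCMorphism_map (f : X →CO Y) :
    IsEOpLCMorphism (localContactStructure X) (localContactStructure Y) (map f) where
  eq_bot_iff U := by
    rw [eq_bot_iff_toSet, eq_bot_iff_toSet, ← closure_empty_iff, closure_toSet_map,
      closure_empty_iff, image_eq_empty]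
  map_sSup S := by
    apply eq_of_closure_eq
    rw [closure_toSet_map, ← closure_image_closure (map_continuous f), closure_toSet_sSup,
      closure_image_closure (map_continuous f), closure_toSet_sSup, image_iUnion₂, biUnion_image]
    refine (closure_mono (iUnion₂_mono fun U _ => subset_regularize _ _)).antisymm
      (closure_minimal (iUnion₂_subset fun U hU => ?_) isClosed_closure)
    refine subset_closure.trans ((closure_toSet_map f U).trans_subset (closure_mono ?_))
    exact subset_biUnion_of_mem (u := fun U : RegularOpens X => f '' U.toSet) hU
  exists_map_eq U V h := by
    have hV : IsOpen (f ⁻¹' V.toSet) := V.isOpen_toSet.preimage (map_continuous f)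
    refine ⟨regularize (U.toSet ∩ f ⁻¹' V.toSet) (U.isOpen_toSet.inter hV), ?_, ?_⟩
    · refine le_iff_subset_closure.2 (subset_closure.trans ?_)
      rw [closure_regularize]
      exact closure_mono inter_subset_left
    · apply eq_of_closure_eq
      rw [closure_toSet_map, ← closure_image_closure (map_continuous f), closure_regularize,
        closure_image_closure (map_continuous f), image_inter_preimage]
      refine (closure_mono inter_subset_right).antisymm
        (closure_minimal (fun y hy => ?_) isClosed_closure)
      -- Since `V` is open and contained in `cl f(U)`, each of its points is a limit of points of `V
      -- ∩ f(U)`.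
      rw [inter_comm]
      refine V.isOpen_toSet.inter_closure ⟨hy, ?_⟩
      rw [← closure_toSet_map]
      exact subset_closure (h hy)
  map_contact U V := by
    rintro ⟨x, hxU, hxV⟩
    refine ⟨f x, ?_, ?_⟩ <;> rw [closure_toSet_map] <;>
      exact image_closure_subset_closure_image (map_continuous f) (mem_image_of_mem f ‹_›)
  map_bounded U hU := by
    rw [localContactStructure, mem_boundedIdeal, closure_toSet_map_of_isCompact f hU]
    exact hU.image (map_continuous f)
  contact_rightAdj U hU V := by
    rintro ⟨y, hyU, hyV⟩
    rw [closure_toSet_map_of_isCompact f hU] at hyU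
    obtain ⟨x, hxU, rfl⟩ := hyU
    have hV : IsOpen (f ⁻¹' V.toSet) := V.isOpen_toSet.preimage (map_continuous f)
    -- Only this half of the description of `ψ_P(V)` as the regularized preimage is needed. Openness
    -- of `f` then puts `f⁻¹(cl V)` inside `cl f⁻¹(V)`.
    have hP : regularize (f ⁻¹' V.toSet) hV ≤ rightAdj (map f) V := by
      refine le_sSup ((map_le_iff f).2 ?_)
      refine (image_mono subset_closure).trans ?_
      rw [closure_regularize]
      exact (image_closure_subset_closure_image (map_continuous f)).trans
        (closure_mono (image_preimage_subset _ _))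
    refine ⟨x, hxU, closure_mono (le_iff.1 hP) ?_⟩
    rw [closure_regularize]
    exact f.map_open'.preimage_closure_subset_closure_preimage hyV

end Map

end RegularOpens

/-- The functor sending a locally compact Hausdorff space to its local contact algebra of regular
open sets. -/
noncomputable def regularOpensFunctor : OpLC.{u} ⥤ EOpLC.{u} where
  obj X := ⟨RegularOpens X.carrier, RegularOpens.localContactStructure X.carrier⟩
  map f := ⟨RegularOpens.map f, RegularOpens.isEOpLCMorphism_map f⟩
  map_id X := by
    refine EOpLC.Hom.ext (funext fun U => RegularOpens.eq_of_closure_eq ?_)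
    exact (RegularOpens.closure_toSet_map _ _).trans (congrArg closure (image_id _))
  map_comp {X Y Z} f g := by
    refine EOpLC.Hom.ext (funext fun U => RegularOpens.eq_of_closure_eq ?_)
    refine (RegularOpens.closure_toSet_map _ _).trans (Eq.trans ?_
      (RegularOpens.closure_toSet_map _ _).symm)
    change closure ((g.toFun ∘ f.toFun) '' _) = closure (g.toFun '' _)
    rw [image_comp, ← RegularOpens.closure_image_closure (f := g.toFun) g.continuous_toFun,
      ← RegularOpens.closure_image_closure (f := g.toFun) g.continuous_toFun
        (RegularOpens.toSet _)]
    exact congrArg (fun s => closure (g.toFun '' s)) (RegularOpens.closure_toSet_map f U).symm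

/-! ### The functor is faithful -/

/-- If `f x ≠ g x`, separate them by `V` and `W`. The open set `f⁻¹(V) ∩ g⁻¹(W)` contains `x`, and
its direct images under `f` and `g` lie in `V` and `W` respectively, so they cannot coincide. -/
theorem RegularOpens.map_injective {X : Type u} {Y : Type v} [TopologicalSpace X]
    [TopologicalSpace Y] [LocallyCompactSpace Y] [T2Space Y] :
    Function.Injective (RegularOpens.map : (X →CO Y) → RegularOpens X → RegularOpens Y) := by
  intro f g h
  ext x
  by_contra hne
  obtain ⟨V, W, hV, hW, hVW⟩ := exists_mem_disjoint hne
  have hO : IsOpen (f ⁻¹' V.toSet ∩ g ⁻¹' W.toSet) :=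
    (V.isOpen_toSet.preimage (map_continuous f)).inter (W.isOpen_toSet.preimage (map_continuous g))
  have hle (k : X →CO Y) (T : RegularOpens Y)
      (hT : f ⁻¹' V.toSet ∩ g ⁻¹' W.toSet ⊆ k ⁻¹' T.toSet) :
      map k (regularize _ hO) ≤ T := by
    refine (map_le_iff k).2 ((image_mono subset_closure).trans ?_)
    rw [closure_regularize]
    exact (image_closure_subset_closure_image (map_continuous k)).trans
      (closure_mono ((image_mono hT).trans (image_preimage_subset _ _)))
  have hx : f x ∈ (map f (regularize _ hO)).toSet :=
    subset_regularize _ _ (mem_image_of_mem f (subset_regularize _ hO ⟨hV, hW⟩))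
  have hxV := hle f V inter_subset_left hx
  have hxW := hle g W inter_subset_right (congrFun h _ ▸ hx)
  exact disjoint_left.1 hVW (subset_closure hxV) (subset_closure hxW)

/-! ### The functor is full -/

namespace IsEOpLCMorphism

theorem monotone {A : Type u} {B : Type v} [CompleteBooleanAlgebra A] [CompleteBooleanAlgebra B]
    {α : LocalContactStructure A} {β : LocalContactStructure B} {ψ : A → B}
    (h : IsEOpLCMorphism α β ψ) : Monotone ψ :=
  (galoisConnection_rightAdj h.map_sSup).monotone_l

open RegularOpens

variable {X : Type u} {Y : Type v} [TopologicalSpace X] [TopologicalSpace Y]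
  [LocallyCompactSpace X] [T2Space X] [LocallyCompactSpace Y] [T2Space Y]
  {ψ : RegularOpens X → RegularOpens Y}
  (h : IsEOpLCMorphism (localContactStructure X) (localContactStructure Y) ψ)

include h

theorem closure_subset_closure {U V : RegularOpens X} (hUV : U ≤ V) :
    closure (ψ U).toSet ⊆ closure (ψ V).toSet :=
  closure_mono (le_iff.1 (h.monotone hUV))

/-- The bounded neighbourhoods of `x` are directed downwards; by (EF1) and (EL5) the sets `cl ψ(U)`
are nonempty and compact for such `U`, so they have a common point. -/
theorem exists_forall_mem_closure (x : X) :
    ∃ y, ∀ U : RegularOpens X, x ∈ U.toSet → y ∈ closure (ψ U).toSet := by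
  let I := {U : RegularOpens X // x ∈ U.toSet ∧ IsCompact (closure U.toSet)}
  have hI (U : RegularOpens X) (hU : x ∈ U.toSet) : ∃ W : I, W.1 ≤ U := by
    obtain ⟨W, hxW, hWU, hW⟩ := exists_mem_between U.isOpen_toSet hU
    exact ⟨⟨W, hxW, hW⟩, le_iff.2 (subset_closure.trans hWU)⟩
  have : Nonempty I := ⟨(hI ⊤ trivial).choose⟩
  obtain ⟨y, hy⟩ := IsCompact.nonempty_iInter_of_directed_nonempty_isCompact_isClosed
    (fun U : I => closure (ψ U.1).toSet)
    (fun U V => by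
      obtain ⟨W, hW⟩ := hI (U.1 ⊓ V.1) ⟨U.2.1, V.2.1⟩
      exact ⟨W, h.closure_subset_closure (hW.trans inf_le_left),
        h.closure_subset_closure (hW.trans inf_le_right)⟩)
    (fun U => by
      refine closure_nonempty_iff.2 (nonempty_iff_ne_empty.2 fun h' => ?_)
      have := (h.eq_bot_iff _).1 (eq_bot_iff_toSet.2 h')
      exact (eq_bot_iff_toSet.1 this ▸ U.2.1 : x ∈ (∅ : Set X)))
    (fun U => h.map_bounded _ U.2.2) (fun _ => isClosed_closure)
  refine ⟨y, fun U hU => ?_⟩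
  obtain ⟨W, hW⟩ := hI U hU
  exact h.closure_subset_closure hW (mem_iInter.1 hy W)

/-- The map of spaces determined by a morphism between algebras of regular open sets. -/
noncomputable def pointMap (x : X) : Y := (h.exists_forall_mem_closure x).choose

theorem pointMap_mem_of_mem {x : X} {U : RegularOpens X} (hx : x ∈ U.toSet) :
    h.pointMap x ∈ closure (ψ U).toSet :=
  (h.exists_forall_mem_closure x).choose_spec U hx

theorem closure_map_rightAdj_subset (V : RegularOpens Y) :
    closure (ψ (rightAdj ψ V)).toSet ⊆ closure V.toSet :=
  closure_mono (le_iff.1 ((galoisConnection_rightAdj h.map_sSup).l_u_le V))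

/-- Forwards: a bounded neighbourhood `W` of `x` away from `cl ψ_P(V)` would satisfy `ψ(W) η V`,
against (EL7). Backwards: if the image point has a neighbourhood `W` with closure disjoint from `cl
V`, the forward half puts `x` in `cl ψ_P(W)`; then `ψ_P(V)` and `ψ_P(W)` are in contact, and by
(EL4) and `ψ ψ_P ≤ id` so are `V` and `W`. -/
theorem pointMap_mem_closure_iff {x : X} {V : RegularOpens Y} :
    h.pointMap x ∈ closure V.toSet ↔ x ∈ closure (rightAdj ψ V).toSet := by
  have key {V : RegularOpens Y} (hV : h.pointMap x ∈ closure V.toSet) :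
      x ∈ closure (rightAdj ψ V).toSet := by
    by_contra hx
    obtain ⟨W, hxW, hWV, hW⟩ := exists_mem_between isClosed_closure.isOpen_compl hx
    obtain ⟨z, hzW, hzV⟩ := h.contact_rightAdj W hW V ⟨_, h.pointMap_mem_of_mem hxW, hV⟩
    exact hWV hzW hzV
  refine ⟨key, fun hx => ?_⟩
  by_contra hV
  obtain ⟨W, hxW, hWV, -⟩ := exists_mem_between isClosed_closure.isOpen_compl hV
  obtain ⟨z, hzV, hzW⟩ := h.map_contact (rightAdj ψ V) (rightAdj ψ W)
    ⟨x, hx, key (subset_closure hxW)⟩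
  exact hWV (h.closure_map_rightAdj_subset W hzW) (h.closure_map_rightAdj_subset V hzV)

theorem pointMap_mem_closure {x : X} {U : RegularOpens X} (hx : x ∈ closure U.toSet) :
    h.pointMap x ∈ closure (ψ U).toSet :=
  h.pointMap_mem_closure_iff.2
    (closure_mono (le_iff.1 ((galoisConnection_rightAdj h.map_sSup).le_u_l U)) hx)

theorem continuous_pointMap : Continuous h.pointMap := by
  refine continuous_def.2 fun O hO => isOpen_iff_mem_nhds.2 fun x hx => ?_
  obtain ⟨W, hxW, hWO, -⟩ := exists_mem_between hO hx
  -- As `W` is the complement of `cl Wᶜ`, the closure criterion exhibits its preimage as the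
  -- complement of a closed set.
  have hW : h.pointMap ⁻¹' W.toSet = (closure (rightAdj ψ Wᶜ).toSet)ᶜ := by
    ext z
    rw [mem_preimage, mem_compl_iff, ← h.pointMap_mem_closure_iff, toSet_eq_compl_closure W,
      mem_compl_iff]
  refine Filter.mem_of_superset ?_ (preimage_mono (subset_closure.trans hWO))
  rw [hW]
  refine isClosed_closure.isOpen_compl.mem_nhds ?_
  rw [← hW]
  exact hxW

/-- The image of `cl U` is compact, hence closed, so a point of `cl ψ(U)` outside it has a
neighbourhood `V` whose closure misses it. But `ψ(U) η V`, and (EL7) gives a point of `cl U` mapped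
into `cl V`. -/
theorem image_pointMap_closure {U : RegularOpens X} (hU : IsCompact (closure U.toSet)) :
    h.pointMap '' closure U.toSet = closure (ψ U).toSet := by
  refine Subset.antisymm (forall_mem_image.2 fun x hx => h.pointMap_mem_closure hx) fun y hy => ?_
  by_contra hyU
  obtain ⟨V, hyV, hVU, -⟩ := exists_mem_between
    (hU.image h.continuous_pointMap).isClosed.isOpen_compl hyU
  obtain ⟨x, hxU, hxV⟩ := h.contact_rightAdj U hU V ⟨y, hy, subset_closure hyV⟩
  exact hVU (h.pointMap_mem_closure_iff.2 hxV) (mem_image_of_mem _ hxU)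

theorem pointMap_mem_toSet {x : X} {U : RegularOpens X} (hx : x ∈ U.toSet) :
    h.pointMap x ∈ (ψ U).toSet := by
  by_contra hU
  rw [toSet_eq_compl_closure, notMem_compl_iff, h.pointMap_mem_closure_iff] at hU
  obtain ⟨z, hzU, hz⟩ := mem_closure_iff.1 hU _ U.isOpen_toSet hx
  -- The image lies below both `ψ U` and its complement; by (EF1) the argument is then zero,
  -- although it contains `z`.
  have hbot : ψ (U ⊓ rightAdj ψ (ψ U)ᶜ) = ⊥ := by
    refine le_bot_iff.1 ((le_inf (h.monotone inf_le_left) ((h.monotone inf_le_right).trans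
      ((galoisConnection_rightAdj h.map_sSup).l_u_le _))).trans_eq inf_compl_eq_bot)
  have := eq_bot_iff_toSet.1 ((h.eq_bot_iff _).1 hbot)
  exact (this ▸ (⟨hzU, hz⟩ : z ∈ (U ⊓ rightAdj ψ (ψ U)ᶜ).toSet) : z ∈ (∅ : Set X))

theorem isOpenMap_pointMap : IsOpenMap h.pointMap := by
  refine fun O hO => isOpen_iff_mem_nhds.2 ?_
  rintro _ ⟨x, hx, rfl⟩
  obtain ⟨W, hxW, hWO, hW⟩ := exists_mem_between hO hx
  refine Filter.mem_of_superset ((ψ W).isOpen_toSet.mem_nhds (h.pointMap_mem_toSet hxW))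
    (subset_closure.trans ?_)
  rw [← h.image_pointMap_closure hW]
  exact image_mono hWO

/-- The continuous open map determined by a morphism between algebras of regular open sets. -/
noncomputable def openMap : X →CO Y := ⟨⟨h.pointMap, h.continuous_pointMap⟩, h.isOpenMap_pointMap⟩

theorem map_openMap : RegularOpens.map h.openMap = ψ := by
  funext U
  apply eq_of_closure_eq
  rw [closure_toSet_map]
  refine (closure_minimal (forall_mem_image.2 fun x hx => h.pointMap_mem_of_mem hx)
    isClosed_closure).antisymm ?_
  -- The image formula is available only for bounded sets, so `U` is written as a join of bounded
  -- sets well inside it and (EF2) is applied.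
  let S := {W : RegularOpens X | IsCompact (closure W.toSet) ∧ closure W.toSet ⊆ U.toSet}
  have hS : U ≤ sSup S := by
    refine le_iff.2 fun x hx => ?_
    obtain ⟨W, hxW, hWU, hW⟩ := exists_mem_between U.isOpen_toSet hx
    exact le_iff.1 (le_sSup (show W ∈ S from ⟨hW, hWU⟩)) hxW
  refine (h.closure_subset_closure hS).trans ?_
  rw [h.map_sSup, closure_toSet_sSup, biUnion_image]
  refine closure_mono (iUnion₂_subset fun W hW => subset_closure.trans ?_)
  rw [← h.image_pointMap_closure hW.1]
  exact image_mono hW.2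

end IsEOpLCMorphism

instance : regularOpensFunctor.{u}.Faithful where
  map_injective h := RegularOpens.map_injective (congrArg EOpLC.Hom.toFun h)

instance : regularOpensFunctor.{u}.Full where
  map_surjective g := ⟨g.isMorphism.openMap, EOpLC.Hom.ext g.isMorphism.map_openMap⟩

/-! ### Non-tangential inclusion -/

namespace IsContactRelation

variable {B : Type u} [BooleanAlgebra B] {C : B → B → Prop} (hC : IsContactRelation C)
  {a a' b b' c : B}

include hC

theorem mono_right (h : C a b) (hb : b ≤ b') : C a b' := by
  rw [← sup_eq_right.2 hb]
  exact (hC.sup_right _ _ _).2 (Or.inl h)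

theorem mono_left (h : C a b) (ha : a ≤ a') : C a' b :=
  hC.symm _ _ (hC.mono_right (hC.symm _ _ h) ha)

theorem nonTangential_mono (ha : a' ≤ a) (h : NonTangential C a b) (hb : b ≤ b') :
    NonTangential C a' b' :=
  fun h' => h (hC.mono_right (hC.mono_left h' ha) (compl_le_compl hb))

theorem nonTangential_compl (h : NonTangential C a b) : NonTangential C bᶜ aᶜ := by
  rw [NonTangential, compl_compl]
  exact fun h' => h (hC.symm _ _ h')

theorem nonTangential_inf (h : NonTangential C a b) (h' : NonTangential C a b') :
    NonTangential C a (b ⊓ b') := by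
  rw [NonTangential, compl_inf, hC.sup_right, not_or]
  exact ⟨h, h'⟩

theorem nonTangential_sup (h : NonTangential C a c) (h' : NonTangential C b c) :
    NonTangential C (a ⊔ b) c := by
  have := hC.nonTangential_compl
    (hC.nonTangential_inf (hC.nonTangential_compl h) (hC.nonTangential_compl h'))
  simpa using this

theorem nonTangential_inf_inf (h : NonTangential C a b) (h' : NonTangential C a' b') :
    NonTangential C (a ⊓ a') (b ⊓ b') :=
  hC.nonTangential_inf (hC.nonTangential_mono inf_le_left h le_rfl)
    (hC.nonTangential_mono inf_le_right h' le_rfl)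

theorem le_of_nonTangential (h : NonTangential C a b) : a ≤ b := by
  by_contra hab
  have hne : a ⊓ bᶜ ≠ ⊥ := fun h' => hab (by rwa [← _root_.sdiff_eq, sdiff_eq_bot_iff] at h')
  exact h (hC.mono_left (hC.mono_right (hC.refl_of_ne_bot _ hne) inf_le_right) inf_le_left)

theorem nonTangential_top : NonTangential C a ⊤ := by
  rw [NonTangential, compl_top]
  exact fun h => (hC.ne_bot _ _ h).2 rfl

theorem bot_nonTangential : NonTangential C ⊥ a :=
  fun h => (hC.ne_bot _ _ h).1 rfl

end IsContactRelation

/-! ### The space of points of a local contact algebra -/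

namespace LocalContactStructure

section Points

variable {B : Type u} [BooleanAlgebra B] (α : LocalContactStructure B)

/-- The points of a local contact algebra: the proper round filters generated by bounded elements
that contain `a` or `bᶜ` whenever `b ≪ a`. -/
@[ext]
structure Point : Type u where
  carrier : Set B
  mem_of_le : ∀ {a b}, a ∈ carrier → a ≤ b → b ∈ carrier
  inf_mem : ∀ {a b}, a ∈ carrier → b ∈ carrier → a ⊓ b ∈ carrier
  bot_notMem : ⊥ ∉ carrier
  exists_bounded : ∀ {a}, a ∈ carrier →
    ∃ b ∈ carrier, b ∈ α.bounded ∧ NonTangential α.contact b a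
  mem_or_compl_mem : ∀ {a b}, NonTangential α.contact b a → a ∈ carrier ∨ bᶜ ∈ carrier

variable {α}

theorem exists_bounded_above {a : B} (ha : a ∈ α.bounded) :
    ∃ b ∈ α.bounded, NonTangential α.contact a b := by
  obtain ⟨b, hb, hab, -⟩ := α.interpolate a ha ⊤ α.isContact.nonTangential_top
  exact ⟨b, hb, hab⟩

/-- The round filter generated by the bounded elements of a suitable proper filter is a point. -/
def Point.ofFilter (Q : Set B) (mem_of_le : ∀ {a b}, a ∈ Q → a ≤ b → b ∈ Q)
    (inf_mem : ∀ {a b}, a ∈ Q → b ∈ Q → a ⊓ b ∈ Q) (bot_notMem : ⊥ ∉ Q)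
    (exists_bounded : ∃ a ∈ Q, a ∈ α.bounded)
    (mem_or_compl_mem : ∀ {a b}, NonTangential α.contact b a → a ∈ Q ∨ bᶜ ∈ Q) : α.Point where
  carrier := {c | ∃ d ∈ Q, d ∈ α.bounded ∧ NonTangential α.contact d c}
  mem_of_le := by
    rintro a b ⟨d, hdQ, hd, hda⟩ hab
    exact ⟨d, hdQ, hd, α.isContact.nonTangential_mono le_rfl hda hab⟩
  inf_mem := by
    rintro a b ⟨d, hdQ, hd, hda⟩ ⟨e, heQ, he, heb⟩
    exact ⟨d ⊓ e, inf_mem hdQ heQ, α.bounded.lower inf_le_left hd,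
      α.isContact.nonTangential_inf_inf hda heb⟩
  bot_notMem := by
    rintro ⟨d, hdQ, -, hd⟩
    exact bot_notMem (mem_of_le hdQ (α.isContact.le_of_nonTangential hd))
  exists_bounded := by
    rintro a ⟨d, hdQ, hd, hda⟩
    obtain ⟨e, he, hde, hea⟩ := α.interpolate d hd a hda
    exact ⟨e, ⟨d, hdQ, hd, hde⟩, he, hea⟩
  mem_or_compl_mem := by
    intro a b hba
    -- Interpolation needs a bounded left side, so `b` is cut down by a bounded `d' ≫ d`. With `b ⊓
    -- d' ≪ e' ≪ e ≪ a`, the filter `Q` decides the pair `e' ≪ e`; intersecting the chosen element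
    -- with `d` makes it bounded, and on `d'` the complement of `b ⊓ d'` lies below `bᶜ`.
    obtain ⟨d, hdQ, hd⟩ := exists_bounded
    obtain ⟨d', hd', hdd'⟩ := exists_bounded_above hd
    obtain ⟨e, -, hbe, hea⟩ := α.interpolate (b ⊓ d') (α.bounded.lower inf_le_right hd') a
      (α.isContact.nonTangential_mono inf_le_left hba le_rfl)
    obtain ⟨e', he', hee', hea'⟩ : ∃ e' ∈ α.bounded, NonTangential α.contact (b ⊓ d') e' ∧
        NonTangential α.contact e' e := α.interpolate _ (α.bounded.lower inf_le_right hd') _ hbe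
    rcases mem_or_compl_mem hea' with h | h
    · exact Or.inl ⟨e ⊓ d, inf_mem h hdQ, α.bounded.lower inf_le_right hd,
        α.isContact.nonTangential_mono inf_le_left hea le_rfl⟩
    · refine Or.inr ⟨e'ᶜ ⊓ d, inf_mem h hdQ, α.bounded.lower inf_le_right hd,
        α.isContact.nonTangential_mono le_rfl (α.isContact.nonTangential_inf_inf
          (α.isContact.nonTangential_compl hee') hdd') ?_⟩
      rw [compl_inf, inf_sup_right, compl_inf_self, sup_bot_eq]
      exact inf_le_left

namespace Point

theorem top_mem (p : α.Point) : ⊤ ∈ p.carrier :=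
  (p.mem_or_compl_mem (α.isContact.nonTangential_top (a := ⊤))).elim id
    fun h => p.mem_of_le h le_top

theorem compl_notMem {p : α.Point} {a : B} (h : a ∈ p.carrier) : aᶜ ∉ p.carrier :=
  fun h' => p.bot_notMem (inf_compl_eq_bot (a := a) ▸ p.inf_mem h h')

/-- Take a nonzero bounded `d ≪ a` and a prime filter containing `d`; the point it generates
contains `a`. -/
theorem exists_mem {a : B} (ha : a ≠ ⊥) : ∃ p : α.Point, a ∈ p.carrier := by
  obtain ⟨d, hd, hd0, hda⟩ := α.exists_bounded_nonTangential a ha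
  obtain ⟨J, hJ, -, hdJ⟩ := DistribLattice.prime_ideal_of_disjoint_filter_ideal
    (F := Order.PFilter.principal d) (I := (⊥ : Order.Ideal B)) (by
      refine disjoint_left.2 fun x hx hx' => hd0 (le_bot_iff.1 ?_)
      exact (Order.PFilter.mem_principal.1 hx).trans hx')
  have hdQ : d ∉ J := fun h => disjoint_left.1 hdJ (Order.PFilter.mem_principal.2 le_rfl) h
  refine ⟨ofFilter {x | x ∉ J} (fun h hab h' => h (J.lower hab h'))
    (fun h h' h'' => (hJ.mem_or_mem h'').elim h h') (fun h => h J.bot_mem) ⟨d, hdQ, hd⟩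
    (fun {x y} h => ?_), d, hdQ, hd, hda⟩
  by_contra! hxy
  simp only [mem_ofPred_eq, not_not] at hxy
  refine hJ.toIsProper.top_notMem ?_
  refine J.lower ?_ (Order.Ideal.sup_mem hxy.1 hxy.2)
  rw [← sup_compl_eq_top (x := y)]
  exact sup_le_sup_right (α.isContact.le_of_nonTangential h) _

variable (α) in
/-- The set of points containing a given element. -/
def basic (a : B) : Set α.Point := {p | a ∈ p.carrier}

instance : TopologicalSpace α.Point where
  IsOpen s := ∀ p ∈ s, ∃ a ∈ p.carrier, basic α a ⊆ s
  isOpen_univ p _ := ⟨⊤, p.top_mem, subset_univ _⟩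
  isOpen_inter s t hs ht p hp := by
    obtain ⟨a, ha, has⟩ := hs p hp.1
    obtain ⟨b, hb, hbt⟩ := ht p hp.2
    exact ⟨a ⊓ b, p.inf_mem ha hb, fun q hq =>
      ⟨has (q.mem_of_le hq inf_le_left), hbt (q.mem_of_le hq inf_le_right)⟩⟩
  isOpen_sUnion S hS p := by
    rintro ⟨s, hs, hp⟩
    obtain ⟨a, ha, has⟩ := hS s hs p hp
    exact ⟨a, ha, has.trans (subset_sUnion_of_mem hs)⟩

theorem isOpen_basic (a : B) : IsOpen (basic α a) := fun _ hp => ⟨a, hp, Subset.rfl⟩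

theorem basic_mono {a b : B} (h : a ≤ b) : basic α a ⊆ basic α b := fun p hp => p.mem_of_le hp h

theorem basic_bot : basic α ⊥ = ∅ := eq_empty_of_forall_notMem fun p => p.bot_notMem

theorem basic_inf (a b : B) : basic α (a ⊓ b) = basic α a ∩ basic α b :=
  Subset.antisymm (subset_inter (basic_mono inf_le_left) (basic_mono inf_le_right))
    fun p hp => p.inf_mem hp.1 hp.2

theorem basic_nonempty {a : B} (ha : a ≠ ⊥) : (basic α a).Nonempty := exists_mem ha

/-- Nonzero elements have points, so `basic α b` misses `basic α a` only when `b ≤ aᶜ`. -/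
theorem mem_closure_basic {a : B} {p : α.Point} : p ∈ closure (basic α a) ↔ aᶜ ∉ p.carrier := by
  rw [mem_closure_iff]
  constructor
  · intro h hp
    obtain ⟨q, hq, hq'⟩ := h _ (isOpen_basic _) hp
    exact compl_notMem hq' hq
  · intro h s hs hp
    obtain ⟨b, hb, hbs⟩ := hs p hp
    have hne : b ⊓ a ≠ ⊥ := fun h' => h (p.mem_of_le hb (le_compl_iff_disjoint_right.2
      (disjoint_iff.2 h')))
    exact (basic_nonempty hne).mono ((basic_inf b a).trans_subset (inter_subset_inter_left _ hbs))

theorem closure_basic_subset_basic {a b : B} (h : NonTangential α.contact a b) :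
    closure (basic α a) ⊆ basic α b :=
  fun p hp => (p.mem_or_compl_mem h).resolve_right (mem_closure_basic.1 hp)

theorem isCompact_closure_basic {a : B} (ha : a ∈ α.bounded) :
    IsCompact (closure (basic α a)) := by
  refine isCompact_iff_ultrafilter_le_nhds.2 fun F hF => ?_
  rw [Filter.le_principal_iff] at hF
  obtain ⟨b, hb, hab⟩ := exists_bounded_above ha
  -- The limit of `F`. The elements `d` with `basic α d ∈ F` need not form a prime filter, but when
  -- `b ≪ a` the sets `basic α a` and `basic α bᶜ` cover the space, so `F` contains one of them.
  -- This weaker property is all that `ofFilter` asks for.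
  let p : α.Point := ofFilter {d | basic α d ∈ F}
    (fun h hle => Filter.mem_of_superset h (basic_mono hle))
    (fun h h' => by
      simp only [mem_ofPred_eq, basic_inf] at h h' ⊢
      exact Filter.inter_mem h h')
    (fun h => F.empty_notMem (basic_bot (α := α) ▸ h))
    ⟨b, Filter.mem_of_superset hF (closure_basic_subset_basic hab), hb⟩
    (fun h => Ultrafilter.union_mem_iff.1
      (Filter.mem_of_superset Filter.univ_mem fun p _ => p.mem_or_compl_mem h))
  have hp {d : B} (hd : d ∈ p.carrier) : basic α d ∈ F := by
    obtain ⟨e, he, -, hed⟩ := hd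
    exact Filter.mem_of_superset he (basic_mono (α.isContact.le_of_nonTangential hed))
  refine ⟨p, mem_closure_basic.2 fun h => ?_, le_nhds_iff.2 fun s hps hs => ?_⟩
  · obtain ⟨q, hq, hq'⟩ := Filter.nonempty_of_mem (Filter.inter_mem hF (hp h))
    exact mem_closure_basic.1 hq hq'
  · obtain ⟨d, hd, hds⟩ := hs p hps
    exact Filter.mem_of_superset (hp hd) hds

/-- Points without disjoint neighbourhoods have the same elements: for `b ≪ a` with `b` in `p`, the
point `q` cannot contain `bᶜ`, so it contains `a`. -/
theorem carrier_subset_of_forall {p q : α.Point}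
    (h : ∀ s t : Set α.Point, IsOpen s → IsOpen t → p ∈ s → q ∈ t → (s ∩ t).Nonempty) :
    p.carrier ⊆ q.carrier := by
  intro a ha
  obtain ⟨b, hb, -, hba⟩ := p.exists_bounded ha
  refine (q.mem_or_compl_mem hba).resolve_right fun hb' => ?_
  obtain ⟨r, hr, hr'⟩ := h _ _ (isOpen_basic b) (isOpen_basic bᶜ) hb hb'
  exact compl_notMem hr hr'

instance : T2Space α.Point := by
  refine ⟨fun p q hpq => ?_⟩
  by_contra! hcon
  have h : ∀ s t : Set α.Point, IsOpen s → IsOpen t → p ∈ s → q ∈ t → (s ∩ t).Nonempty :=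
    fun s t hs ht hp hq => not_disjoint_iff_nonempty_inter.1 (hcon s t hs ht hp hq)
  refine hpq (Point.ext ((carrier_subset_of_forall h).antisymm (carrier_subset_of_forall ?_)))
  exact fun s t hs ht hp hq => inter_comm t s ▸ h t s ht hs hq hp

instance : LocallyCompactSpace α.Point := by
  refine ⟨fun p s hs => ?_⟩
  obtain ⟨t, hts, ht, hpt⟩ := mem_nhds_iff.1 hs
  obtain ⟨a, ha, hat⟩ := ht p hpt
  obtain ⟨b, hb, hbb, hba⟩ := p.exists_bounded ha
  exact ⟨closure (basic α b), Filter.mem_of_superset ((isOpen_basic b).mem_nhds hb) subset_closure,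
    ((closure_basic_subset_basic hba).trans hat).trans hts, isCompact_closure_basic hbb⟩

theorem interior_closure_basic (a : B) : interior (closure (basic α a)) = basic α a := by
  have h : closure (basic α a) = (basic α aᶜ)ᶜ := by
    ext p
    exact mem_closure_basic
  rw [h, interior_compl]
  ext p
  rw [mem_compl_iff, mem_closure_basic, not_not, compl_compl]
  rfl

theorem le_of_closure_basic_subset {a b : B} (h : basic α a ⊆ closure (basic α b)) : a ≤ b := by
  by_contra hab
  have hne : a ⊓ bᶜ ≠ ⊥ := fun h' => hab (by rwa [← _root_.sdiff_eq, sdiff_eq_bot_iff] at h')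
  obtain ⟨p, hp⟩ := basic_nonempty (α := α) hne
  exact mem_closure_basic.1 (h (basic_mono inf_le_left hp)) (basic_mono inf_le_right hp)

/-- Compactness in algebraic form: a property stable under finite joins that holds locally along `cl
(basic α a)` holds for a single element above `a`. -/
theorem exists_le_of_isCompact_closure_basic {a : B} (ha : IsCompact (closure (basic α a)))
    (P : B → Prop) (hbot : P ⊥) (hsup : ∀ b c, P b → P c → P (b ⊔ c))
    (hP : ∀ p ∈ closure (basic α a), ∃ b ∈ p.carrier, P b) : ∃ b, P b ∧ a ≤ b := by
  suffices ∃ b, P b ∧ closure (basic α a) ⊆ basic α b by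
    obtain ⟨b, hb, hab⟩ := this
    exact ⟨b, hb, le_of_closure_basic_subset (subset_closure.trans (hab.trans subset_closure))⟩
  refine ha.induction_on ⟨⊥, hbot, empty_subset _⟩
    (fun s t hst ⟨b, hb, htb⟩ => ⟨b, hb, hst.trans htb⟩) ?_ fun p hp => ?_
  · rintro s t ⟨b, hb, hsb⟩ ⟨c, hc, htc⟩
    exact ⟨b ⊔ c, hsup b c hb hc, union_subset (hsb.trans (basic_mono le_sup_left))
      (htc.trans (basic_mono le_sup_right))⟩
  · obtain ⟨b, hb, hPb⟩ := hP p hp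
    exact ⟨_, mem_nhdsWithin_of_mem_nhds ((isOpen_basic b).mem_nhds hb), b, hPb, Subset.rfl⟩

theorem isCompact_closure_basic_iff {a : B} :
    IsCompact (closure (basic α a)) ↔ a ∈ α.bounded := by
  refine ⟨fun h => ?_, isCompact_closure_basic⟩
  obtain ⟨b, hb, hab⟩ := exists_le_of_isCompact_closure_basic h (· ∈ α.bounded) α.bounded.bot_mem
    (fun b c hb hc => Order.Ideal.sup_mem hb hc) (fun p _ => by
      obtain ⟨b, hb, hbb, -⟩ := p.exists_bounded p.top_mem
      exact ⟨b, hb, hbb⟩)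
  exact α.bounded.lower hab hb

theorem contact_iff {a b : B} :
    α.contact a b ↔ (closure (basic α a) ∩ closure (basic α b)).Nonempty := by
  constructor
  · intro h
    -- Replacing `a` by the bounded `c ⊓ a` makes the closure compact while keeping contact with
    -- `b`. If the closures were disjoint, every point there would contain some `d ≪ bᶜ`, and a
    -- finite join of these would give `c ⊓ a ≪ bᶜ`.
    obtain ⟨c, hc, hcb⟩ := α.exists_bounded_contact b a (α.isContact.symm _ _ h)
    have hca : c ⊓ a ∈ α.bounded := α.bounded.lower inf_le_left hc
    by_contra hempty
    obtain ⟨d, hd, had⟩ := exists_le_of_isCompact_closure_basic (isCompact_closure_basic hca)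
      (fun d => NonTangential α.contact d bᶜ) α.isContact.bot_nonTangential
      (fun _ _ => α.isContact.nonTangential_sup) (fun p hp => by
        have hpb : bᶜ ∈ p.carrier := by
          by_contra hpb
          exact hempty ⟨p, closure_mono (basic_mono inf_le_right) hp, mem_closure_basic.2 hpb⟩
        obtain ⟨d, hd, -, hdb⟩ := p.exists_bounded hpb
        exact ⟨d, hd, hdb⟩)
    refine α.isContact.nonTangential_mono had hd le_rfl ?_
    rw [compl_compl]
    exact α.isContact.symm _ _ hcb
  · rintro ⟨p, hpa, hpb⟩
    by_contra h
    have h' : NonTangential α.contact a bᶜ := by rwa [NonTangential, compl_compl]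
    exact (p.mem_or_compl_mem h').elim (mem_closure_basic.1 hpb) (mem_closure_basic.1 hpa)

end Point

end Points

/-! ### Representation of complete local contact algebras -/

section Representation

variable {B : Type u} [CompleteBooleanAlgebra B] {α : LocalContactStructure B}

open Point

/-- The regular open set of points containing a given element. -/
def basicRegularOpen (α : LocalContactStructure B) (a : B) : RegularOpens α.Point :=
  RegularOpens.regularize (basic α a) (isOpen_basic a)

theorem toSet_basicRegularOpen (a : B) : (α.basicRegularOpen a).toSet = basic α a := by
  rw [basicRegularOpen, RegularOpens.toSet_regularize, interior_closure_basic]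

theorem basicRegularOpen_le_iff {a b : B} :
    α.basicRegularOpen a ≤ α.basicRegularOpen b ↔ a ≤ b := by
  rw [RegularOpens.le_iff, toSet_basicRegularOpen, toSet_basicRegularOpen]
  exact ⟨fun h => le_of_closure_basic_subset (h.trans subset_closure), basic_mono⟩

theorem basicRegularOpen_surjective : Function.Surjective α.basicRegularOpen := by
  intro U
  refine ⟨sSup {a | basic α a ⊆ U.toSet}, le_antisymm ?_ ?_⟩
  · refine RegularOpens.le_iff_subset_closure.2 fun p hp => ?_
    rw [toSet_basicRegularOpen] at hp
    refine mem_closure_iff.2 fun s hs hps => ?_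
    obtain ⟨c, hc, hcs⟩ := hs p hps
    by_contra hempty
    refine p.bot_notMem (p.mem_of_le (p.inf_mem hc hp) ?_)
    -- If `basic α c` misses `U`, then `c` meets every `a` with `basic α a ⊆ U` in zero, and by
    -- infinite distributivity it is disjoint from their join.
    rw [inf_sSup_eq]
    refine iSup₂_le fun a ha => ?_
    by_contra hne
    obtain ⟨q, hq⟩ := basic_nonempty (α := α) (a := c ⊓ a) fun h => hne h.le
    exact hempty ⟨q, hcs (basic_mono inf_le_left hq), ha (basic_mono inf_le_right hq)⟩
  · rw [RegularOpens.le_iff, toSet_basicRegularOpen]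
    intro p hp
    obtain ⟨a, ha, haU⟩ := U.isOpen_toSet p hp
    exact basic_mono (le_sSup (show a ∈ {a | basic α a ⊆ U.toSet} from haU)) ha

variable (α) in
/-- A complete local contact algebra is isomorphic to the regular open algebra of its space of
points. -/
noncomputable def representation : B ≃o RegularOpens α.Point :=
  RelIso.ofSurjective
    (OrderEmbedding.ofMapLEIff α.basicRegularOpen fun _ _ => basicRegularOpen_le_iff)
    basicRegularOpen_surjective

end Representation

end LocalContactStructure

/-! ### Essential surjectivity and the equivalence. -/

theorem OrderIso.isEOpLCMorphism {A : Type u} {B : Type v} [CompleteBooleanAlgebra A]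
    [CompleteBooleanAlgebra B] {α : LocalContactStructure A} {β : LocalContactStructure B}
    (e : A ≃o B) (hc : ∀ a b, β.contact (e a) (e b) ↔ α.contact a b)
    (hb : ∀ a, e a ∈ β.bounded ↔ a ∈ α.bounded) : IsEOpLCMorphism α β e where
  eq_bot_iff a := map_eq_bot_iff e
  map_sSup S := by rw [e.map_sSup, sSup_image]
  exists_map_eq a b h := ⟨e.symm b, (e.symm_apply_le).2 h, e.apply_symm_apply b⟩
  map_contact a b := (hc a b).2
  map_bounded a := (hb a).2
  contact_rightAdj a _ b h := by
    have h1 : rightAdj e b = e.symm b := by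
      have : {a | e a ≤ b} = Iic (e.symm b) := Set.ext fun a => (e.le_symm_apply).symm
      rw [rightAdj, this]
      exact isLUB_Iic.sSup_eq
    rwa [h1, ← hc, e.apply_symm_apply]

/-- An isomorphism of local contact algebras is an isomorphism in the category `EOpLC`. -/
def EOpLC.isoOfOrderIso {A B : EOpLC.{u}} (e : A.carrier ≃o B.carrier)
    (hc : ∀ a b, B.str.contact (e a) (e b) ↔ A.str.contact a b)
    (hb : ∀ a, e a ∈ B.str.bounded ↔ a ∈ A.str.bounded) : A ≅ B where
  hom := ⟨e, e.isEOpLCMorphism hc hb⟩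
  inv := ⟨e.symm, e.symm.isEOpLCMorphism (fun a b => by
    rw [← hc, e.apply_symm_apply, e.apply_symm_apply]) (fun a => by
    rw [← hb, e.apply_symm_apply])⟩
  hom_inv_id := EOpLC.Hom.ext (funext e.symm_apply_apply)
  inv_hom_id := EOpLC.Hom.ext (funext e.apply_symm_apply)

open LocalContactStructure in
instance : regularOpensFunctor.{u}.EssSurj where
  mem_essImage A := by
    refine ⟨⟨A.str.Point⟩, ⟨(EOpLC.isoOfOrderIso (A := A)
      (B := regularOpensFunctor.obj ⟨A.str.Point⟩) A.str.representation ?_ ?_).symm⟩⟩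
    · intro a b
      refine Iff.trans ?_ Point.contact_iff.symm
      rw [← toSet_basicRegularOpen, ← toSet_basicRegularOpen]
      rfl
    · intro a
      refine Iff.trans ?_ Point.isCompact_closure_basic_iff
      rw [← toSet_basicRegularOpen]
      rfl

theorem theorem4p7 : Nonempty (OpLC.{u} ≌ EOpLC.{u}) := by
  have : regularOpensFunctor.{u}.IsEquivalence := {}
  exact ⟨regularOpensFunctor.asEquivalence⟩
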